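/- Let $n\ge 1$, let $\mathbb{T}=(\overline{\mathbb{Q}}^{*})^n$ be the $n$-dimensional torus over $\overline{\mathbb{Q}}$, and for an integer $n\times n$ matrix $A$ let $\phi(A):\mathbb{T}\to\mathbb{T}$ be the monomial map $\phi(A)(x)_i=\prod_j x_j^{A_{ij}}$. Let $M,N$ be $n\times n$ integer matrices with non-zero determinant, and let $f=(\mathbb{T},\phi(M),\phi(N))$ be the associated monomial correspondence. Write $f^p=(\Gamma_p,u_p,v_p)$ for its $p$-th iterate, defined by fibre products; for $x\in\mathbb{T}(\overline{\mathbb{Q}})$ let $f^p(x)=v_{p*}u_p^*[x]=\sum_{\gamma\in\Gamma_p,\,u_p(\gamma)=x}[v_p(\gamma)]$ be the image zero-cycle. Embed $\mathbb{T}$ in $\mathbb{P}^n$ by $x\mapsto[1:x_1:\dots:x_n]$, let $D$ be an ample divisor of degree $d\geq 1$ on $\mathbb{P}^n$, let $h_D=d\cdot h$, where $h\ge 0$ is the standard absolute logarithmic Weil height on $\mathbb{P}^n(\overline{\mathbb{Q}})$, and put $h_D(\sum_i a_i[x_i])=\sum_i a_i h_D(x_i)$ for zero-cycles on $\mathbb{T}$.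 Define the arithmetic degree of $x$ by $$\alpha_f(x)=\limsup_{p\to+\infty}\,h_D^{+}(f^p(x))^{1/p},\qquad h_D^{+}=\max(1,h_D).$$ Then for every $x\in\mathbb{T}(\overline{\mathbb{Q}})$ the quantity $\alpha_f(x)$ is finite and belongs to the set $$\{1,\,|\det(M)\rho_1|,\,\dots,\,|\det(M)\rho_n|\},$$ where $\rho_1,\dots,\rho_n\in\mathbb{C}$ are the eigenvalues of $N\cdot M^{-1}$. Moreover, if at least one coordinate of $x$ is not a root of unity, then $\alpha_f(x)=\limsup_{p\to+\infty}h_D(f^p(x))^{1/p}$, i.e. the convention $h_D^+$ is not needed. -/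

import Mathlib

open Filter

noncomputable section

/-- The field `ℚ̄` of algebraic numbers. -/
abbrev QBar : Type := AlgebraicClosure ℚ

/-- The `ℚ̄`-points of the `n`-dimensional torus `𝕋`. -/
abbrev Torus (n : ℕ) : Type := Fin n → QBarˣ

/-- The monomial map `φ(A)` of the torus, `φ(A)(x)_i = ∏_j x_j ^ (A i j)`. -/
def monomialMap {n : ℕ} (A : Matrix (Fin n) (Fin n) ℤ) (x : Torus n) : Torus n :=
  fun i => ∏ j, x j ^ A i j

/-! ### Correspondences and zero-cycles -/

/-- The data of a correspondence `(Γ, π₁, π₂)` from `X` to `Y`, on the level of points.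
For `π₁` finite étale over an algebraically closed field (the only case used below) the points of
the varieties determine iterates and images of points: every fibre product that occurs is reduced,
and every point of a fibre of `π₁` has multiplicity one. -/
structure Correspondence (X Y : Type) where
  graph : Type
  left : graph → X
  right : graph → Y

namespace Correspondence

/-- The identity correspondence. -/
protected def id (X : Type) : Correspondence X X where
  graph := X
  left := fun x => x
  right := fun x => x

/-- The composite `g ∘ f`, whose graph is the fibre product `Γ_f ×_Y Γ_g`. -/
def comp {X Y Z : Type} (g : Correspondence Y Z) (f : Correspondence X Y) :
    Correspondence X Z where
  graph := {γ : f.graph × g.graph // f.right γ.1 = g.left γ.2}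
  left := fun γ => f.left γ.1.1
  right := fun γ => g.right γ.1.2

/-- The `p`-th iterate `f^p = f ∘ ⋯ ∘ f`. -/
def iterate {X : Type} (f : Correspondence X X) : ℕ → Correspondence X X
  | 0 => Correspondence.id X
  | p + 1 => (f.iterate p).comp f

/-- The image of a point `x`: the zero-cycle `π₂_* π₁^* [x] = ∑_{π₁(γ) = x} [π₂(γ)]`, a formal
integral combination of points of `Y`. It is meaningful when the fibre of `π₁` over `x` is
finite. -/
def image {X Y : Type} (f : Correspondence X Y) (x : X) : Y →₀ ℤ :=
  ∑ᶠ γ : {γ : f.graph // f.left γ = x}, Finsupp.single (f.right γ.1) 1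

end Correspondence

/-- The monomial correspondence `(𝕋, φ(M), φ(N))`. -/
def monomialCorrespondence {n : ℕ} (M N : Matrix (Fin n) (Fin n) ℤ) :
    Correspondence (Torus n) (Torus n) where
  graph := Torus n
  left := monomialMap M
  right := monomialMap N

theorem monomialMap_mul {n : ℕ} (A B : Matrix (Fin n) (Fin n) ℤ) (x : Torus n) :
    monomialMap (A * B) x = monomialMap A (monomialMap B x) := by
  funext i
  simp only [monomialMap, Matrix.mul_apply, ← Finset.prod_zpow, ← zpow_mul]
  rw [Finset.prod_comm]
  refine Finset.prod_congr rfl fun j _ => ?_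
  have key : ∀ (s : Finset (Fin n)) (g : Fin n → ℤ),
      x j ^ ∑ l ∈ s, g l = ∏ l ∈ s, x j ^ g l := fun s g => by
    classical
    induction s using Finset.induction_on with
    | empty => simp
    | insert a s ha ih => rw [Finset.sum_insert ha, Finset.prod_insert ha, zpow_add, ih]
  rw [key]
  exact Finset.prod_congr rfl fun l _ => by rw [mul_comm]

/-! ### Heights -/

theorem numberField_adjoin_range {n : ℕ} (x : Torus n) :
    NumberField (IntermediateField.adjoin ℚ (Set.range fun i => (x i : QBar))) := by
  have : FiniteDimensional ℚ
      (IntermediateField.adjoin ℚ (Set.range fun i => (x i : QBar))) :=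
    IntermediateField.finiteDimensional_adjoin fun z _ => by
      have h := (AlgebraicClosure.isAlgebraic ℚ).isAlgebraic z
      convert h.isIntegral using 1
      exact Subsingleton.elim _ _
  exact {}

/-- The absolute logarithmic Weil height on `ℙⁿ(ℚ̄)` of a point `x` of the torus, embedded as
`[1 : x₁ : ⋯ : x_n]`: the logarithmic height relative to the number field `K = ℚ(x₁, …, x_n)`
divided by `[K : ℚ]`. -/
def torusHeight {n : ℕ} (x : Torus n) : ℝ :=
  let K := IntermediateField.adjoin ℚ (Set.range fun i => (x i : QBar))
  haveI : NumberField K := numberField_adjoin_range x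
  Height.logHeight (Fin.cons 1 (fun i =>
    ⟨(x i : QBar), IntermediateField.subset_adjoin ℚ _ ⟨i, rfl⟩⟩) : Fin (n + 1) → K)
    / (Module.finrank ℚ K : ℝ)

/-- The height `h_D` on the torus for a divisor `D` of degree `d` on `ℙⁿ`, `h_D = d · h`. -/
def weilHeight {n : ℕ} (d : ℕ) (x : Torus n) : ℝ := (d : ℝ) * torusHeight x

/-- The height of a zero-cycle, `h_D (∑ aᵢ [xᵢ]) = ∑ aᵢ h_D(xᵢ)`. -/
def cycleHeight {n : ℕ} (d : ℕ) (c : Torus n →₀ ℤ) : ℝ :=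
  c.sum fun y a => (a : ℝ) * weilHeight d y

/-- The sequence `p ↦ h_D(f^p(x))`. -/
def orbitHeight {n : ℕ} (d : ℕ) (f : Correspondence (Torus n) (Torus n)) (x : Torus n) (p : ℕ) :
    ℝ :=
  cycleHeight d ((f.iterate p).image x)

/-- The arithmetic degree `α_f(x) = limsup_p h_D⁺(f^p(x))^{1/p}` in `[0, ∞]`, with the usual
convention `h_D⁺ = max(1, h_D)`. -/
def arithmeticDegree {n : ℕ} (d : ℕ) (f : Correspondence (Torus n) (Torus n)) (x : Torus n) :
    ENNReal :=
  limsup (fun p : ℕ => ENNReal.ofReal (max 1 (orbitHeight d f x p)) ^ (1 / (p : ℝ))) atTop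

end

/-- The complex eigenvalues of the rational matrix `N M⁻¹`. -/
def IsEigenvalueOfQuotient {n : ℕ} (M N : Matrix (Fin n) (Fin n) ℤ) (ρ : ℂ) : Prop :=
  Module.End.HasEigenvalue
    (Matrix.toLin' (N.map (Int.cast : ℤ → ℂ) * (M.map (Int.cast : ℤ → ℂ))⁻¹)) ρ

/-- All fibres over points used to define the image of a point under an iterate of a monomial
correspondence are finite. -/
theorem finite_fibre_iterate_monomialCorrespondence {n : ℕ} (M N : Matrix (Fin n) (Fin n) ℤ)
    (hM : M.det ≠ 0) (p : ℕ) (x : Torus n) :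
    {γ | ((monomialCorrespondence M N).iterate p).left γ = x}.Finite := by
  have h1 : ∀ y : Torus n, {z : Torus n | monomialMap M z = y}.Finite := by
    intro y
    set k := M.det.natAbs with hk
    have hk0 : 0 < k := Int.natAbs_pos.mpr hM
    have hsub : {z : Torus n | monomialMap M z = y} ⊆
        Set.pi Set.univ fun i => {u : QBarˣ | u ^ M.det = monomialMap M.adjugate y i} := by
      intro z hz i _
      have hz' : monomialMap M z = y := hz
      show z i ^ M.det = _
      rw [← hz', ← monomialMap_mul, Matrix.adjugate_mul]
      simp only [monomialMap, Matrix.smul_apply, Matrix.one_apply, smul_eq_mul]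
      rw [Finset.prod_eq_single i] <;> simp +contextual [eq_comm]
    refine Set.Finite.subset (Set.Finite.pi fun i => ?_) hsub
    have key : ∀ c : QBarˣ, {u : QBarˣ | u ^ k = c}.Finite := by
      intro c
      classical
      have : Set.Finite {v : QBar | v ^ k = (c : QBar)} := by
        refine (Polynomial.nthRoots k (c : QBar)).toFinset.finite_toSet.subset ?_
        intro v hv
        simpa [Polynomial.mem_nthRoots hk0] using hv
      refine (this.preimage (f := fun u : QBarˣ => (u : QBar)) Units.val_injective.injOn).subset ?_
      intro u hu
      have hu' : u ^ k = c := hu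
      show ((u : QBar)) ^ k = c
      rw [← hu', Units.val_pow_eq_pow_val]
    rcases Int.natAbs_eq M.det with h | h
    · refine (key (monomialMap M.adjugate y i)).subset fun u hu => ?_
      have hu' : u ^ M.det = _ := hu
      rw [h, zpow_natCast] at hu'
      exact hu'
    · refine (key (monomialMap M.adjugate y i)⁻¹).subset fun u hu => ?_
      have hu' : u ^ M.det = _ := hu
      rw [h, zpow_neg, zpow_natCast] at hu'
      show u ^ k = _
      rw [← hu', inv_inv]
  induction p generalizing x with
  | zero => exact (Set.finite_singleton x).subset fun γ hγ => hγ
  | succ p ih =>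
    let f := monomialCorrespondence M N
    have h2 : (⋃ w ∈ {w : Torus n | monomialMap M w = x},
        (fun γ => (w, γ)) '' {γ | (f.iterate p).left γ = monomialMap N w}).Finite :=
      (h1 x).biUnion fun w _ => (ih _).image _
    refine (h2.preimage (f := fun γ : (f.iterate (p + 1)).graph => γ.1)
      (Subtype.val_injective.injOn)).subset ?_
    rintro ⟨⟨w, γ⟩, hγ⟩ hx
    exact Set.mem_biUnion (show w ∈ {w : Torus n | monomialMap M w = x} from hx)
      ⟨γ, hγ.symm, rfl⟩

/-! Put `k = |det M|` and `B = k N M⁻¹`, an integer matrix. The cycle `f^p(x)` has `k^p` points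
counted with multiplicity, and each point `y` satisfies `y^(k^p) = φ(B^p)(x)`. The height is
multiplicative in powers, so `h_D(f^p(x)) = d · h(φ(B^p)(x))` exactly (`orbitHeight_eq`): the
correspondence grows like the single monomial map `φ(B)`.

On the group generated by the coordinates of `x`, twice the height is a weighted sum of absolute
values of linear forms in the exponents, whose coefficients are the logarithms `log |x_j|_v`. So
`h(φ(B^p)(x))` is comparable to `‖T^p u‖`, where `u` collects these logarithms and `T` is `B` acting
at each place. Such an orbit grows like `‖μ‖^p` for an eigenvalue `μ` of `B`
(`exists_hasEigenvalue_norm_iterate`), and `μ / k` is an eigenvalue of `N M⁻¹`.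

If all coordinates are roots of unity, every height vanishes and the degree is 1. Otherwise
Northcott's theorem bounds the heights below by a positive constant, so `‖μ‖ ≥ 1` and the truncation
at 1 changes nothing. -/

/-! ### Growth of linear orbits and of p-th roots. -/

/-- Peel off one root at a time: `T u - μ • u` is killed by the remaining factors. The strict
inequality `‖μ‖ < s` absorbs the polynomial factors of Jordan blocks. -/
theorem norm_iterate_le_of_prod_sub_eq_zero {V : Type*} [NormedAddCommGroup V] [NormedSpace ℂ V]
    (T : Module.End ℂ V) {s : ℝ} (hs : 0 < s) (m : Multiset ℂ) (hm : ∀ μ ∈ m, ‖μ‖ < s) (u : V)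
    (hu : Polynomial.aeval T (m.map fun μ => Polynomial.X - Polynomial.C μ).prod u = 0) :
    ∃ C > 0, ∀ p : ℕ, ‖(T ^ p) u‖ ≤ C * s ^ p := by
  induction m using Multiset.induction_on generalizing u with
  | empty =>
    have hu0 : u = 0 := by simpa using hu
    exact ⟨1, one_pos, fun p => by simp [hu0, hs.le]⟩
  | cons μ m ih =>
    obtain ⟨C, hC, h⟩ := ih (fun ν hν => hm ν (Multiset.mem_cons_of_mem hν)) (T u - μ • u) (by
      rw [Multiset.map_cons, Multiset.prod_cons, mul_comm, map_mul, Module.End.mul_apply] at hu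
      simpa [Module.algebraMap_end_apply] using hu)
    have hμ : 0 < s - ‖μ‖ := sub_pos.mpr (hm μ (Multiset.mem_cons_self μ m))
    -- Chosen so that `‖μ‖ D + C ≤ s D`, which closes the recursion.
    set D := max ‖u‖ (C / (s - ‖μ‖))
    have hD : C / (s - ‖μ‖) ≤ D := le_max_right _ _
    have hD' : C ≤ D * (s - ‖μ‖) := (div_le_iff₀ hμ).mp hD
    refine ⟨D, lt_of_lt_of_le (div_pos hC hμ) hD, fun p => ?_⟩
    induction p with
    | zero => simp [D]
    | succ p hp =>
      have hstep : (T ^ (p + 1)) u = μ • (T ^ p) u + (T ^ p) (T u - μ • u) := by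
        rw [pow_succ, Module.End.mul_apply, map_sub, map_smul]
        abel
      calc ‖(T ^ (p + 1)) u‖ ≤ ‖μ‖ * ‖(T ^ p) u‖ + ‖(T ^ p) (T u - μ • u)‖ := by
            rw [hstep]
            exact (norm_add_le _ _).trans (by rw [norm_smul])
        _ ≤ ‖μ‖ * (D * s ^ p) + (D * (s - ‖μ‖)) * s ^ p := by
            gcongr
            exact (h p).trans (by gcongr)
        _ = D * s ^ (p + 1) := by ring

/-- The orbit of a non-zero vector under an endomorphism of a finite-dimensional complex space
grows like the powers of the modulus of an eigenvalue. -/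
theorem exists_hasEigenvalue_norm_iterate {V : Type*} [NormedAddCommGroup V] [NormedSpace ℂ V]
    [FiniteDimensional ℂ V] (T : Module.End ℂ V) {u : V} (hu : u ≠ 0) :
    ∃ μ : ℂ, T.HasEigenvalue μ ∧ (∃ c > 0, ∀ p : ℕ, c * ‖μ‖ ^ p ≤ ‖(T ^ p) u‖) ∧
      ∀ s, ‖μ‖ < s → ∃ C > 0, ∀ p : ℕ, ‖(T ^ p) u‖ ≤ C * s ^ p := by
  classical
  let Q : Multiset ℂ → Polynomial ℂ := fun m =>
    (m.map fun μ => Polynomial.X - Polynomial.C μ).prod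
  -- A multiset of least size stands in for the minimal polynomial of `u`: dropping any root leaves
  -- a polynomial in `T` that does not kill `u`.
  have hex : ∃ k : ℕ, ∃ m : Multiset ℂ, m.card = k ∧ Polynomial.aeval T (Q m) u = 0 := by
    refine ⟨_, (minpoly ℂ T).roots, rfl, ?_⟩
    have hsplit := (IsAlgClosed.splits (minpoly ℂ T)).eq_prod_roots_of_monic
      (minpoly.monic (Algebra.IsIntegral.isIntegral T))
    have : Q (minpoly ℂ T).roots = minpoly ℂ T := hsplit.symm
    rw [this, minpoly.aeval]
    rfl
  obtain ⟨m, hcard, hm⟩ := Nat.find_spec hex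
  have hmin : ∀ m' : Multiset ℂ, m'.card < m.card → Polynomial.aeval T (Q m') u ≠ 0 :=
    fun m' hlt h => Nat.find_min hex (hcard ▸ hlt) ⟨m', rfl, h⟩
  have hm0 : m.toFinset.Nonempty := by
    rw [Multiset.toFinset_nonempty]
    rintro rfl
    exact hu (by simpa [Q] using hm)
  -- Dropping the root `μ` of largest modulus makes `S u` an eigenvector for `μ`. As `S` commutes
  -- with `T` and is bounded, `‖T^p u‖` is at least a constant times `‖μ‖^p`.
  obtain ⟨μ, hμm, hμ⟩ := m.toFinset.exists_max_image (fun ν => ‖ν‖) hm0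
  rw [Multiset.mem_toFinset] at hμm
  obtain ⟨m', rfl⟩ := Multiset.exists_cons_of_mem hμm
  set S := Polynomial.aeval T (Q m')
  have hw : S u ≠ 0 := hmin m' (by simp)
  have hQ : Q (μ ::ₘ m') = (Polynomial.X - Polynomial.C μ) * Q m' := by simp [Q]
  have hTw : T (S u) = μ • S u := by
    rw [hQ, map_mul, Module.End.mul_apply] at hm
    simpa [Module.algebraMap_end_apply, sub_eq_zero, S] using hm
  have heig : T.HasEigenvector μ (S u) := ⟨Module.End.mem_eigenspace_iff.mpr hTw, hw⟩
  refine ⟨μ, Module.End.hasEigenvalue_of_hasEigenvector heig, ?_, fun s hs => ?_⟩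
  · let S' := LinearMap.toContinuousLinearMap S
    have hcomm : ∀ p : ℕ, S ((T ^ p) u) = (T ^ p) (S u) := fun p => by
      have : S * T ^ p = T ^ p * S := by
        have h := mul_comm (Q m') (Polynomial.X ^ p)
        simpa [S] using congrArg (Polynomial.aeval T) h
      exact LinearMap.congr_fun this u
    refine ⟨‖S u‖ / (‖S'‖ + 1), by positivity, fun p => ?_⟩
    have h1 : ‖S u‖ * ‖μ‖ ^ p ≤ (‖S'‖ + 1) * ‖(T ^ p) u‖ := by
      calc ‖S u‖ * ‖μ‖ ^ p = ‖S' ((T ^ p) u)‖ := by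
            change _ = ‖S ((T ^ p) u)‖
            rw [hcomm, heig.pow_apply, norm_smul, norm_pow, mul_comm]
        _ ≤ ‖S'‖ * ‖(T ^ p) u‖ := S'.le_opNorm _
        _ ≤ _ := by gcongr; simp
    rw [div_mul_eq_mul_div, div_le_iff₀ (by positivity)]
    linarith
  · exact norm_iterate_le_of_prod_sub_eq_zero T ((norm_nonneg μ).trans_lt hs) _
      (fun ν hν => (hμ ν (Multiset.mem_toFinset.mpr hν)).trans_lt hs) u hm

theorem tendsto_ofReal_mul_pow_rpow {c r : ℝ} (hc : 0 < c) (hr : 0 ≤ r) :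
    Tendsto (fun p : ℕ => ENNReal.ofReal (c * r ^ p) ^ (1 / (p : ℝ))) atTop
      (nhds (ENNReal.ofReal r)) := by
  have h0 : Tendsto (fun p : ℕ => 1 / (p : ℝ)) atTop (nhds 0) :=
    tendsto_one_div_atTop_nhds_zero_nat
  have h1 : Tendsto (fun p : ℕ => c ^ (1 / (p : ℝ)) * r) atTop (nhds r) := by
    have := ((Real.continuousAt_const_rpow hc.ne').tendsto.comp h0).mul_const r
    simpa using this
  refine (ENNReal.tendsto_ofReal h1).congr' ?_
  filter_upwards [eventually_gt_atTop 0] with p hp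
  rw [ENNReal.ofReal_rpow_of_nonneg (by positivity) (by positivity),
    Real.mul_rpow hc.le (by positivity), one_div, Real.pow_rpow_inv_natCast hr hp.ne']

/-- Constants disappear under p-th roots, and an upper bound for each `s > r` is enough. -/
theorem limsup_rpow_eq_ofReal {a : ℕ → ℝ} {r : ℝ} (hr : 0 ≤ r)
    (hlow : ∃ c > 0, ∀ p : ℕ, c * r ^ p ≤ a p)
    (hup : ∀ s, r < s → ∃ C > 0, ∀ p : ℕ, a p ≤ C * s ^ p) :
    limsup (fun p : ℕ => ENNReal.ofReal (a p) ^ (1 / (p : ℝ))) atTop = ENNReal.ofReal r := by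
  apply le_antisymm
  · refine le_of_forall_gt fun t ht => ?_
    obtain ⟨s, hs, hst⟩ := ENNReal.lt_iff_exists_real_btwn.mp ht
    obtain ⟨hs0, hst⟩ := hst
    have hrs : r < s := (ENNReal.ofReal_lt_ofReal_iff_of_nonneg hr).mp hs0
    obtain ⟨C, hC, h⟩ := hup s hrs
    refine lt_of_le_of_lt ?_ hst
    rw [← (tendsto_ofReal_mul_pow_rpow hC (hr.trans hrs.le)).limsup_eq]
    refine limsup_le_limsup (Eventually.of_forall fun p => ?_)
    exact ENNReal.rpow_le_rpow (ENNReal.ofReal_le_ofReal (h p)) (by positivity)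
  · obtain ⟨c, hc, h⟩ := hlow
    rw [← (tendsto_ofReal_mul_pow_rpow hc hr).limsup_eq]
    refine limsup_le_limsup (Eventually.of_forall fun p => ?_)
    exact ENNReal.rpow_le_rpow (ENNReal.ofReal_le_ofReal (h p)) (by positivity)

/-! ### Monomial maps as homomorphisms and the size of their fibres. -/

theorem monomialMap_mul_right {n : ℕ} (A : Matrix (Fin n) (Fin n) ℤ) (x y : Torus n) :
    monomialMap A (x * y) = monomialMap A x * monomialMap A y := by
  funext i
  simp [monomialMap, mul_zpow, Finset.prod_mul_distrib]

theorem monomialMap_smul_one {n : ℕ} (k : ℤ) (x : Torus n) :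
    monomialMap (k • (1 : Matrix (Fin n) (Fin n) ℤ)) x = x ^ k := by
  funext i
  simp only [monomialMap, Matrix.smul_apply, Matrix.one_apply, smul_eq_mul, Pi.pow_apply]
  rw [Finset.prod_eq_single i] <;> simp +contextual [eq_comm]

/-- The monomial map as a group homomorphism. -/
noncomputable def monomialHom {n : ℕ} (A : Matrix (Fin n) (Fin n) ℤ) : Torus n →* Torus n :=
  MonoidHom.mk' (monomialMap A) (monomialMap_mul_right A)

theorem exists_zpow_eq_torus {n : ℕ} {k : ℤ} (hk : k ≠ 0) (y : Torus n) :
    ∃ x : Torus n, x ^ k = y := by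
  have key : ∀ c : QBarˣ, ∃ u : QBarˣ, u ^ k.natAbs = c := fun c => by
    obtain ⟨z, hz⟩ := IsAlgClosed.exists_pow_nat_eq (c : QBar) (Int.natAbs_pos.mpr hk)
    have hz0 : z ≠ 0 := by
      rintro rfl
      rw [zero_pow (Int.natAbs_ne_zero.mpr hk)] at hz
      exact c.ne_zero hz.symm
    exact ⟨Units.mk0 z hz0, Units.ext (by simpa using hz)⟩
  choose g hg using key
  rcases Int.natAbs_eq k with h | h
  · refine ⟨fun i => g (y i), funext fun i => ?_⟩
    rw [h, zpow_natCast]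
    exact hg _
  · refine ⟨fun i => g (y i)⁻¹, funext fun i => ?_⟩
    rw [h, zpow_neg, zpow_natCast]
    simp [hg]

theorem monomialMap_surjective {n : ℕ} {M : Matrix (Fin n) (Fin n) ℤ} (hM : M.det ≠ 0) :
    Function.Surjective (monomialMap M) := fun y => by
  obtain ⟨x, rfl⟩ := exists_zpow_eq_torus hM y
  exact ⟨monomialMap M.adjugate x, by
    rw [← monomialMap_mul, Matrix.mul_adjugate, monomialMap_smul_one]⟩

theorem card_quotient_span_rows {n : ℕ} {M : Matrix (Fin n) (Fin n) ℤ} (hM : M.det ≠ 0) :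
    Nat.card ((Fin n → ℤ) ⧸ Submodule.span ℤ (Set.range M.row)) = M.det.natAbs := by
  have hli : LinearIndependent ℤ M.row := Matrix.linearIndependent_rows_of_det_ne_zero hM
  let b := Module.Basis.span hli
  rw [← Submodule.natAbs_det_basis_change (Pi.basisFun ℤ (Fin n)) _ b]
  have h : (Subtype.val ∘ b : Fin n → Fin n → ℤ) = M.row :=
    funext fun i => congrArg Subtype.val (Module.Basis.span_apply hli i)
  rw [h, Pi.basisFun_det, Matrix.detRowAlternating]
  rfl

/-- A finite abelian group has as many characters as elements, since `QBar` contains all the roots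
of unity needed. -/
theorem card_linearMap_quotient_span_rows {n : ℕ} {M : Matrix (Fin n) (Fin n) ℤ} (hM : M.det ≠ 0) :
    Nat.card (((Fin n → ℤ) ⧸ Submodule.span ℤ (Set.range M.row)) →ₗ[ℤ] Additive QBarˣ)
      = M.det.natAbs := by
  set Q := (Fin n → ℤ) ⧸ Submodule.span ℤ (Set.range M.row)
  have hcard : Nat.card Q = M.det.natAbs := card_quotient_span_rows hM
  have : Finite Q := Nat.finite_of_card_ne_zero (by rw [hcard]; exact Int.natAbs_ne_zero.mpr hM)
  have : NeZero (Monoid.exponent (Multiplicative Q)) :=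
    ⟨Monoid.exponent_ne_zero_of_finite⟩
  rw [← hcard, Nat.card_congr (Multiplicative.ofAdd (α := Q)),
    ← CommGroup.card_monoidHom_of_hasEnoughRootsOfUnity (Multiplicative Q) QBar]
  exact Nat.card_congr ((addMonoidHomLequivInt ℤ).toEquiv.symm.trans
    AddMonoidHom.toMultiplicativeLeft)

/-- A point of the torus is a homomorphism from `ℤ^n` to `QBarˣ`. It lies in the kernel exactly when
it kills the rows of `M`, so the kernel is the dual of `ℤ^n` modulo the rows. -/
theorem card_ker_monomialHom {n : ℕ} {M : Matrix (Fin n) (Fin n) ℤ} (hM : M.det ≠ 0) :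
    Nat.card (monomialHom M).ker = M.det.natAbs := by
  rw [← card_linearMap_quotient_span_rows hM]
  set R := Submodule.span ℤ (Set.range M.row)
  have hdec : ∀ a : Fin n → ℤ, a = ∑ j, a j • (Pi.single j 1 : Fin n → ℤ) := fun a => by
    simpa using ((Pi.basisFun ℤ (Fin n)).sum_repr a).symm
  let b := Pi.basisFun ℤ (Fin n)
  have hlift : ∀ x ∈ (monomialHom M).ker,
      R ≤ LinearMap.ker (b.constr ℤ fun j => Additive.ofMul (x j)) := by
    intro x hx
    refine Submodule.span_le.mpr ?_
    rintro _ ⟨i, rfl⟩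
    have h : monomialMap M x i = 1 := congrFun (MonoidHom.mem_ker.mp hx) i
    rw [SetLike.mem_coe, LinearMap.mem_ker, Module.Basis.constr_apply_fintype]
    apply Additive.toMul.injective
    simpa [b, monomialMap] using h
  refine Nat.card_congr
    { toFun := fun x => R.liftQ _ (hlift x.1 x.2)
      invFun := fun ψ => ⟨fun j => (ψ (R.mkQ (Pi.single j 1))).toMul, ?_⟩
      left_inv := fun x => ?_
      right_inv := fun ψ => ?_ }
  · rw [MonoidHom.mem_ker]
    funext i
    have h : ψ (R.mkQ (M.row i)) = 0 := by
      rw [Submodule.mkQ_apply, (Submodule.Quotient.mk_eq_zero R).mpr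
        (Submodule.subset_span ⟨i, rfl⟩), map_zero]
    rw [hdec (M.row i), map_sum, map_sum] at h
    simp only [map_smul] at h
    simpa [monomialHom, monomialMap] using congrArg Additive.toMul h
  · ext j
    simp [b]
  · refine Submodule.linearMap_qext _ (b.ext fun j => ?_)
    simp [b]

theorem card_fibre_monomialMap {n : ℕ} {M : Matrix (Fin n) (Fin n) ℤ} (hM : M.det ≠ 0)
    (y : Torus n) : Nat.card {w : Torus n // monomialMap M w = y} = M.det.natAbs := by
  obtain ⟨x, rfl⟩ := monomialMap_surjective hM y
  rw [← card_ker_monomialHom hM]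
  refine Nat.card_congr ((Equiv.mulRight x⁻¹).subtypeEquiv fun w => ?_)
  change monomialHom M w = monomialHom M x ↔ w * x⁻¹ ∈ (monomialHom M).ker
  rw [MonoidHom.mem_ker, map_mul, map_inv, mul_inv_eq_one]

/-! ### Fibres and images of the iterated correspondence. -/

/-- Sort the fibre by its first component `w` in the fibre of `φ(M)`: what remains is a fibre of the
`p`-th iterate over `φ(N)(w)`. -/
theorem card_fibre_iterate {n : ℕ} {M : Matrix (Fin n) (Fin n) ℤ} (hM : M.det ≠ 0)
    (N : Matrix (Fin n) (Fin n) ℤ) (p : ℕ) (x : Torus n) :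
    Nat.card {γ // ((monomialCorrespondence M N).iterate p).left γ = x} = M.det.natAbs ^ p := by
  induction p generalizing x with
  | zero =>
    rw [pow_zero]
    exact Nat.card_unique (α := {γ : Torus n // γ = x})
  | succ p ih =>
    let f := monomialCorrespondence M N
    let e : {γ // (f.iterate (p + 1)).left γ = x} ≃
        Σ w : {w : Torus n // monomialMap M w = x},
          {γ // (f.iterate p).left γ = monomialMap N w.1} :=
      { toFun := fun γ => ⟨⟨γ.1.1.1, γ.2⟩, ⟨γ.1.1.2, γ.1.2.symm⟩⟩
        invFun := fun γ => ⟨⟨⟨γ.1.1, γ.2.1⟩, γ.2.2.symm⟩, γ.1.2⟩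
        left_inv := fun _ => rfl
        right_inv := fun _ => rfl }
    have : ∀ w : {w : Torus n // monomialMap M w = x},
        Finite {γ // (f.iterate p).left γ = monomialMap N w.1} := fun w =>
      Nat.finite_of_card_ne_zero (by
        rw [ih]; exact pow_ne_zero _ (Int.natAbs_ne_zero.mpr hM))
    have : Finite {w : Torus n // monomialMap M w = x} :=
      Nat.finite_of_card_ne_zero (by
        rw [card_fibre_monomialMap hM]; exact Int.natAbs_ne_zero.mpr hM)
    have := Fintype.ofFinite {w : Torus n // monomialMap M w = x}
    rw [Nat.card_congr e, Nat.card_sigma, Finset.sum_congr rfl fun w _ => ih _, Finset.sum_const,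
      Finset.card_univ, ← Nat.card_eq_fintype_card, card_fibre_monomialMap hM, smul_eq_mul,
      pow_succ']

/-- The integer matrix `|det M| N M⁻¹`. -/
def quotientMatrix {n : ℕ} (M N : Matrix (Fin n) (Fin n) ℤ) : Matrix (Fin n) (Fin n) ℤ :=
  M.det.sign • (N * M.adjugate)

theorem quotientMatrix_mul {n : ℕ} (M N : Matrix (Fin n) (Fin n) ℤ) :
    quotientMatrix M N * M = M.det.natAbs • N := by
  rw [quotientMatrix, smul_mul_assoc, mul_assoc, Matrix.adjugate_mul, mul_smul_comm, mul_one,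
    smul_smul, Int.sign_mul_self, ← natCast_zsmul, Int.natCast_natAbs]

/-- For one step from `φ(M)(w)` to `φ(N)(w)`, the relation `B M = |det M| N` gives `φ(B)(φ(M)(w)) =
φ(N)(w)^|det M|`. Consequently all image points of `x` have the same height. -/
theorem iterate_right_pow {n : ℕ} (M N : Matrix (Fin n) (Fin n) ℤ) (p : ℕ)
    (γ : ((monomialCorrespondence M N).iterate p).graph) :
    ((monomialCorrespondence M N).iterate p).right γ ^ (M.det.natAbs ^ p) =
      monomialMap (quotientMatrix M N ^ p) (((monomialCorrespondence M N).iterate p).left γ) := by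
  induction p with
  | zero =>
    have h : ∀ x : Torus n, x ^ (M.det.natAbs ^ 0) = monomialMap (quotientMatrix M N ^ 0) x := by
      intro x
      have h1 := monomialMap_smul_one 1 x
      rw [one_smul, zpow_one] at h1
      rw [pow_zero, pow_zero, pow_one, h1]
    exact h γ
  | succ p ih =>
    obtain ⟨⟨w, γ⟩, hγ⟩ := γ
    have h : ∀ w x : Torus n, monomialMap N w = x →
        monomialMap (quotientMatrix M N ^ p) x ^ M.det.natAbs =
          monomialMap (quotientMatrix M N ^ (p + 1)) (monomialMap M w) := by
      rintro w _ rfl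
      rw [← monomialMap_mul, ← monomialMap_mul, pow_succ, mul_assoc, quotientMatrix_mul,
        ← natCast_zsmul, mul_smul_comm, ← zpow_natCast, ← monomialMap_smul_one, ← monomialMap_mul,
        smul_mul_assoc, one_mul]
    refine Eq.trans ?_ (h w _ hγ)
    rw [← ih, ← pow_mul, ← pow_succ]
    rfl

theorem det_quotientMatrix_ne_zero {n : ℕ} {M N : Matrix (Fin n) (Fin n) ℤ} (hM : M.det ≠ 0)
    (hN : N.det ≠ 0) : (quotientMatrix M N).det ≠ 0 := by
  have h := congrArg Matrix.det (quotientMatrix_mul M N)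
  rw [← natCast_zsmul, Matrix.det_mul, Matrix.det_smul] at h
  intro h0
  rw [h0, zero_mul] at h
  exact mul_ne_zero (pow_ne_zero _ (by simpa using hM)) hN h.symm

/-! ### Behaviour of the height under extension of number fields. -/

section HeightExtension

open NumberField Height

theorem prod_infinitePlace_pow_mult {K α : Type*} [Field K] [NumberField K] [CommMonoid α]
    (g : InfinitePlace K → α) :
    ∏ v : InfinitePlace K, g v ^ v.mult = ∏ φ : K →+* ℂ, g (InfinitePlace.mk φ) := by
  classical
  rw [← Finset.prod_fiberwise Finset.univ InfinitePlace.mk fun φ : K →+* ℂ => g (.mk φ)]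
  refine Finset.prod_congr rfl fun v _ => ?_
  rw [Finset.prod_congr rfl (g := fun _ => g v) fun φ hφ => by
    rw [(Finset.mem_filter.mp hφ).2], Finset.prod_const, InfinitePlace.card_filter_mk_eq]

theorem card_embeddings_extending {K L : Type*} [Field K] [NumberField K] [Field L] [NumberField L]
    [Algebra K L] (φ : K →+* ℂ) :
    Nat.card {ψ : L →+* ℂ // ψ.comp (algebraMap K L) = φ} = Module.finrank K L := by
  let := φ.toAlgebra
  have : FiniteDimensional K L := Module.Finite.of_restrictScalars_finite ℚ K L
  rw [← AlgHom.card K L ℂ, ← Nat.card_eq_fintype_card]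
  exact Nat.card_congr
    { toFun := fun ψ => { ψ.1 with commutes' := fun r => RingHom.congr_fun ψ.2 r }
      invFun := fun ψ => ⟨ψ.toRingHom, RingHom.ext fun r => ψ.commutes r⟩
      left_inv := fun _ => rfl
      right_inv := fun _ => rfl }

theorem prod_embeddings_comp_algebraMap {K L α : Type*} [Field K] [NumberField K] [Field L]
    [NumberField L] [Algebra K L] [CommMonoid α] (g : (K →+* ℂ) → α) :
    ∏ ψ : L →+* ℂ, g (ψ.comp (algebraMap K L)) = (∏ φ : K →+* ℂ, g φ) ^ Module.finrank K L := by
  classical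
  rw [← Finset.prod_fiberwise Finset.univ (fun ψ : L →+* ℂ => ψ.comp (algebraMap K L)),
    ← Finset.prod_pow]
  refine Finset.prod_congr rfl fun φ _ => ?_
  rw [Finset.prod_congr rfl (g := fun _ => g φ) fun ψ hψ => by
    rw [(Finset.mem_filter.mp hψ).2], Finset.prod_const, ← card_embeddings_extending (L := L) φ,
    Nat.card_eq_fintype_card, Fintype.card_subtype]

/-- Each complex embedding of `K` extends to `L` in `[L : K]` ways. For an integral tuple the finite
part is the inverse norm of the ideal spanned by the coordinates, and extending an ideal to `L`
raises its norm to the power `[L : K]`. No splitting of primes has to be followed. -/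
theorem mulHeight_algebraMap_integers {K L ι : Type*} [Field K] [NumberField K] [Field L]
    [NumberField L] [Algebra K L] [Finite ι] {x : ι → 𝓞 K} (hx : x ≠ 0) :
    mulHeight (fun i => algebraMap K L (x i)) =
      mulHeight (fun i => (x i : K)) ^ Module.finrank K L := by
  have hxK : (fun i => (x i : K)) ≠ 0 := by
    obtain ⟨i, hi⟩ := Function.ne_iff.mp hx
    exact Function.ne_iff.mpr ⟨i, by simpa using hi⟩
  set y : ι → 𝓞 L := fun i => algebraMap (𝓞 K) (𝓞 L) (x i)
  have hcoe : ∀ i, algebraMap K L (x i) = (y i : L) := fun i => rfl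
  have hxL : (fun i => algebraMap K L (x i)) ≠ 0 := by
    obtain ⟨i, hi⟩ := Function.ne_iff.mp hxK
    exact Function.ne_iff.mpr ⟨i, by simpa using hi⟩
  have hy : y ≠ 0 := by
    obtain ⟨i, hi⟩ := Function.ne_iff.mp hxL
    exact Function.ne_iff.mpr ⟨i, fun h => hi (by simp [hcoe, h])⟩
  have hfinK := absNorm_mul_finprod_finitePlace_eq_one hx
  have hfinL := absNorm_mul_finprod_finitePlace_eq_one hy
  have hspan : Ideal.span (Set.range y) =
      (Ideal.span (Set.range x)).map (algebraMap (𝓞 K) (𝓞 L)) := by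
    rw [Ideal.map_span, ← Set.range_comp]
    rfl
  have hrank : Module.finrank (𝓞 K) (𝓞 L) = Module.finrank K L :=
    (IsFractionRing.finrank_eq (𝓞 K) K (𝓞 L) L).symm
  rw [hspan, Ideal.absNorm_algebraMap, hrank] at hfinL
  rw [NumberField.mulHeight_eq hxL, NumberField.mulHeight_eq hxK, mul_pow]
  congr 1
  · rw [prod_infinitePlace_pow_mult fun v : InfinitePlace L => ⨆ i, v (algebraMap K L (x i)),
      prod_infinitePlace_pow_mult fun v : InfinitePlace K => ⨆ i, v (x i),
      ← prod_embeddings_comp_algebraMap (L := L)]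
    rfl
  · simp only [hcoe]
    have h0 : ((Ideal.span (Set.range x)).absNorm : ℝ) ≠ 0 := left_ne_zero_of_mul_eq_one hfinK
    apply mul_left_cancel₀ (pow_ne_zero (Module.finrank K L) h0)
    rw [← mul_pow, hfinK, one_pow, ← hfinL]
    push_cast
    rfl

/-- The height relative to an extension `L / K` is the `[L : K]`-th power of that
relative to `K`. -/
theorem mulHeight_algebraMap {K L ι : Type*} [Field K] [NumberField K] [Field L]
    [NumberField L] [Algebra K L] [Finite ι] (x : ι → K) :
    mulHeight (fun i => algebraMap K L (x i)) = mulHeight x ^ Module.finrank K L := by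
  rcases eq_or_ne x 0 with rfl | hx
  · have : (fun i : ι => algebraMap K L ((0 : ι → K) i)) = 0 := by funext i; simp
    rw [this, mulHeight_zero, mulHeight_zero, one_pow]
  -- Clearing denominators reduces to integral tuples, as the height is invariant under scaling.
  obtain ⟨b, hb⟩ := IsLocalization.exist_integer_multiples_of_finite (nonZeroDivisors (𝓞 K)) x
  choose y hy using hb
  have hb0 : ((b : 𝓞 K) : K) ≠ 0 := by simp
  have hsmul : (fun i => (y i : K)) = ((b : 𝓞 K) : K) • x := funext fun i =>
    (hy i).trans (Algebra.smul_def _ _)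
  have hy0 : y ≠ 0 := by
    rintro rfl
    refine smul_ne_zero hb0 hx (hsmul.symm.trans ?_)
    funext i
    simp
  have h := mulHeight_algebraMap_integers (L := L) hy0
  rw [hsmul, mulHeight_smul_eq_mulHeight x hb0] at h
  rw [← h, ← mulHeight_smul_eq_mulHeight (c := algebraMap K L ((b : 𝓞 K) : K)) _ (by simp)]
  congr 1
  funext i
  simp [congrFun hsmul i]

theorem logHeight_algebraMap {K L ι : Type*} [Field K] [NumberField K] [Field L]
    [NumberField L] [Algebra K L] [Finite ι] (x : ι → K) :
    logHeight (fun i => algebraMap K L (x i)) = Module.finrank K L * logHeight x := by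
  rw [logHeight_eq_log_mulHeight, mulHeight_algebraMap, Real.log_pow, logHeight_eq_log_mulHeight]

end HeightExtension

/-! ### The absolute height on the torus and the height of the image cycle. -/

-- Frees the height from the field generated by the point, so that a point and its powers can be
-- compared inside one field.
open Height in
theorem torusHeight_eq {n : ℕ} (x : Torus n) (L : IntermediateField ℚ QBar) [NumberField L]
    (h : ∀ i, (x i : QBar) ∈ L) :
    torusHeight x =
      logHeight (Fin.cons 1 (fun i => ⟨x i, h i⟩) : Fin (n + 1) → L) / Module.finrank ℚ L := by
  rw [torusHeight]
  set K := IntermediateField.adjoin ℚ (Set.range fun i => (x i : QBar))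
  have : NumberField K := numberField_adjoin_range x
  have hle : K ≤ L := IntermediateField.adjoin_le_iff.mpr (by rintro _ ⟨i, rfl⟩; exact h i)
  let := (IntermediateField.inclusion hle).toRingHom.toAlgebra
  have hrank : Module.finrank ℚ K * Module.finrank K L = Module.finrank ℚ L :=
    Module.finrank_mul_finrank ℚ K L
  set y : Fin (n + 1) → K := Fin.cons 1 fun i =>
    ⟨x i, IntermediateField.subset_adjoin ℚ _ ⟨i, rfl⟩⟩
  have hyL : (Fin.cons 1 (fun i => ⟨x i, h i⟩) : Fin (n + 1) → L) =
      fun i => algebraMap K L (y i) := by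
    funext i
    refine Fin.cases ?_ (fun j => ?_) i
    · simp [y]
    · rfl
  change logHeight y / (Module.finrank ℚ K : ℝ) = _
  rw [hyL, logHeight_algebraMap, ← hrank]
  have h1 : (Module.finrank ℚ K : ℝ) ≠ 0 := by
    exact_mod_cast (Module.finrank_pos (R := ℚ) (M := K)).ne'
  have : FiniteDimensional K L := Module.Finite.of_restrictScalars_finite ℚ K L
  have h2 : (Module.finrank K L : ℝ) ≠ 0 := by
    exact_mod_cast (Module.finrank_pos (R := K) (M := L)).ne'
  push_cast
  field_simp

theorem torusHeight_pow {n : ℕ} (x : Torus n) (k : ℕ) :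
    torusHeight (x ^ k) = k * torusHeight x := by
  let K := IntermediateField.adjoin ℚ (Set.range fun i => (x i : QBar))
  have : NumberField K := numberField_adjoin_range x
  have h : ∀ i, (x i : QBar) ∈ K := fun i => IntermediateField.subset_adjoin ℚ _ ⟨i, rfl⟩
  rw [torusHeight_eq (x ^ k) K (fun i => by simpa using pow_mem (h i) k), torusHeight_eq x K h,
    ← mul_div_assoc, ← Height.logHeight_pow]
  congr 2
  funext i
  refine Fin.cases ?_ (fun j => ?_) i
  · simp
  · ext
    simp

theorem torusHeight_eq_zero_of_isOfFinOrder {n : ℕ} {x : Torus n} (h : ∀ i, IsOfFinOrder (x i)) :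
    torusHeight x = 0 := by
  obtain ⟨k, hk, hxk⟩ := isOfFinOrder_iff_pow_eq_one.mp (IsOfFinOrder.pi h)
  have h1 := torusHeight_pow x k
  -- Exponent 0 yields `torusHeight 1 = 0`.
  have h2 := torusHeight_pow (1 : Torus n) 0
  rw [hxk] at h1
  rw [one_pow, Nat.cast_zero, zero_mul] at h2
  rw [h2] at h1
  exact (mul_eq_zero.mp h1.symm).resolve_left (Nat.cast_ne_zero.mpr hk.ne')

theorem cycleHeight_sum_single {n : ℕ} (d : ℕ) {ι : Type*} (s : Finset ι) (z : ι → Torus n) :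
    cycleHeight d (∑ i ∈ s, Finsupp.single (z i) 1) = ∑ i ∈ s, weilHeight d (z i) := by
  classical
  rw [cycleHeight, ← Finsupp.sum_finsetSum_index (by simp) (by intros; push_cast; ring)]
  exact Finset.sum_congr rfl fun i _ => by simp

/-- The `|det M|^p` fibre points each contribute the same height, divided by `|det M|^p`; the two
factors cancel. -/
theorem orbitHeight_eq {n : ℕ} {M : Matrix (Fin n) (Fin n) ℤ} (hM : M.det ≠ 0)
    (N : Matrix (Fin n) (Fin n) ℤ) (d : ℕ) (x : Torus n) (p : ℕ) :
    orbitHeight d (monomialCorrespondence M N) x p =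
      d * torusHeight (monomialMap (quotientMatrix M N ^ p) x) := by
  set f := (monomialCorrespondence M N).iterate p
  have hcard : Nat.card {γ // f.left γ = x} = M.det.natAbs ^ p := card_fibre_iterate hM N p x
  have hpos : M.det.natAbs ^ p ≠ 0 := pow_ne_zero _ (Int.natAbs_ne_zero.mpr hM)
  have : Finite {γ // f.left γ = x} := Nat.finite_of_card_ne_zero (by rwa [hcard])
  have := Fintype.ofFinite {γ // f.left γ = x}
  have hpt : ∀ γ : {γ // f.left γ = x}, weilHeight d (f.right γ.1) =
      d * torusHeight (monomialMap (quotientMatrix M N ^ p) x) / (M.det.natAbs ^ p : ℕ) := by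
    rintro ⟨γ, rfl⟩
    rw [← iterate_right_pow, torusHeight_pow, weilHeight, eq_div_iff (Nat.cast_ne_zero.mpr hpos)]
    ring
  rw [orbitHeight, Correspondence.image, finsum_eq_sum_of_fintype, cycleHeight_sum_single,
    Finset.sum_congr rfl fun γ _ => hpt γ, Finset.sum_const, Finset.card_univ,
    ← Nat.card_eq_fintype_card, hcard, nsmul_eq_mul,
    mul_div_cancel₀ _ (Nat.cast_ne_zero.mpr hpos)]

/-! ### Northcott bounds and growth of heights along powers of a matrix. -/

section HeightGrowth

open NumberField Height

theorem logHeight₁_le_logHeight_cons_one {K : Type*} [Field K] [NumberField K] {n : ℕ}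
    (y : Fin n → K) (i : Fin n) :
    logHeight₁ (y i) ≤ logHeight (Fin.cons 1 y : Fin (n + 1) → K) := by
  rw [logHeight₁_eq_logHeight]
  convert logHeight_comp_le ![i.succ, 0] (Fin.cons 1 y : Fin (n + 1) → K) using 2
  funext j
  fin_cases j <;> simp

/-- The Segre embedding of the points `[y_i : 1]` has height equal to the sum, and `1` and all `y_i`
occur among its coordinates. -/
theorem logHeight_cons_one_le_sum {K : Type*} [Field K] [NumberField K] {n : ℕ}
    (y : Fin n → K) :
    logHeight (Fin.cons 1 y : Fin (n + 1) → K) ≤ ∑ i, logHeight₁ (y i) := by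
  classical
  simp only [logHeight₁_eq_logHeight]
  rw [← logHeight_fun_prod_eq (x := fun i => ![y i, 1]) (fun i h => by simpa using congrFun h 1)]
  convert logHeight_comp_le (Fin.cons (fun _ => 1) (fun i a => if a = i then 0 else 1))
    (fun I : Fin n → Fin 2 => ∏ i, ![y i, 1] (I i)) using 2
  funext j
  refine Fin.cases ?_ (fun i => ?_) j
  · simp
  · simp only [Fin.cons_succ, Function.comp_apply]
    rw [Finset.prod_eq_single i] <;> simp +contextual

/-- Kronecker's theorem: all powers of `a` have height 0, and by Northcott only finitely many
elements do. -/
theorem isOfFinOrder_of_logHeight₁_eq_zero {K : Type*} [Field K] [NumberField K] {a : Kˣ}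
    (ha : logHeight₁ (a : K) = 0) : IsOfFinOrder a := by
  by_contra hinf
  have hinj : Function.Injective fun k : ℕ => ((a ^ k : Kˣ) : K) :=
    Units.val_injective.comp (injective_pow_iff_not_isOfFinOrder.mpr hinf)
  refine Set.infinite_range_of_injective hinj
    ((finite_setOfPred_logHeight₁_le (K := K) 0).subset ?_)
  rintro _ ⟨k, rfl⟩
  change logHeight₁ ((a ^ k : Kˣ) : K) ≤ 0
  rw [Units.val_pow_eq_pow_val, logHeight₁_pow, ha, mul_zero]

/-- By Northcott only finitely many heights lie in `(0, 1]`, so a smallest one exists. -/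
theorem exists_pos_le_logHeight₁ (K : Type*) [Field K] [NumberField K] :
    ∃ c > 0, ∀ a : Kˣ, ¬ IsOfFinOrder a → c ≤ logHeight₁ (a : K) := by
  have hfin : {a : K | logHeight₁ a ≤ 1}.Finite := finite_setOfPred_logHeight₁_le (K := K) 1
  have hfin' := (hfin.subset (t := {a : K | logHeight₁ a ≤ 1 ∧ 0 < logHeight₁ a})
    fun a h => h.1).image logHeight₁
  obtain ⟨c, hc, h⟩ : ∃ c > 0, ∀ a : K, logHeight₁ a ≤ 1 → 0 < logHeight₁ a → c ≤ logHeight₁ a := by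
    rcases (logHeight₁ '' {a : K | logHeight₁ a ≤ 1 ∧ 0 < logHeight₁ a}).eq_empty_or_nonempty
      with h | h
    · refine ⟨1, one_pos, fun a h1 h2 => ?_⟩
      exact (Set.eq_empty_iff_forall_notMem.mp h _ ⟨a, ⟨h1, h2⟩, rfl⟩).elim
    · obtain ⟨_, ⟨b, hb, rfl⟩, hmin⟩ := hfin'.exists_minimalFor id _ h
      refine ⟨logHeight₁ b, hb.2, fun a h1 h2 => ?_⟩
      by_contra! hlt
      exact absurd (hmin ⟨a, ⟨h1, h2⟩, rfl⟩ hlt.le) (not_le.mpr hlt)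
  refine ⟨min c 1, lt_min hc one_pos, fun a ha => ?_⟩
  rcases le_total (logHeight₁ (a : K)) 1 with h1 | h1
  · refine (min_le_left _ _).trans (h a h1 ((zero_le_logHeight₁ (a : K)).lt_of_ne' fun h0 => ?_))
    exact ha (isOfFinOrder_of_logHeight₁_eq_zero h0)
  · exact (min_le_right _ _).trans h1

/-- On a finitely generated multiplicative group the height is a weighted sum of absolute values
of linear forms in the exponents. -/
theorem exists_two_mul_logHeight₁_prod_zpow {K : Type} [Field K] [NumberField K] {n : ℕ}
    (x : Fin n → K) (hx : ∀ i, x i ≠ 0) :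
    ∃ (ι : Type) (_ : Fintype ι) (l : ι → Fin n → ℝ) (w : ι → ℝ), (∀ v, 1 ≤ w v) ∧
      ∀ a : Fin n → ℤ, 2 * logHeight₁ (∏ j, x j ^ a j) = ∑ v, w v * |∑ j, a j * l v j| := by
  classical
  have hfin : ∀ j, (Function.mulSupport fun v : FinitePlace K => v (x j)).Finite := fun j =>
    FinitePlace.hasFiniteMulSupport (hx j)
  -- Outside `S` every `x j` has absolute value 1, so one finite set of places serves all exponents.
  set S : Finset (FinitePlace K) := Finset.univ.biUnion fun j => (hfin j).toFinset
  have hS : ∀ v ∉ S, ∀ j, v (x j) = 1 := by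
    intro v hv j
    by_contra h
    exact hv (Finset.mem_biUnion.mpr ⟨j, Finset.mem_univ j, by simpa using h⟩)
  have hlogS : ∀ v ∉ S, ∀ a : Fin n → ℤ, v (∏ j, x j ^ a j) = 1 := by
    intro v hv a
    simp [map_prod, map_zpow₀, hS v hv]
  have hlog : ∀ (v : AbsoluteValue K ℝ) (a : Fin n → ℤ),
      Real.log (v (∏ j, x j ^ a j)) = ∑ j, a j * Real.log (v (x j)) := by
    intro v a
    rw [map_prod, Real.log_prod fun j _ => by simp [zpow_ne_zero, hx j]]
    simp [map_zpow₀, Real.log_zpow]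
  -- An element and its inverse have equal height; adding the two turns `log⁺` into `|log|`, whence
  -- the factor 2.
  have habs : ∀ r : ℝ, Real.posLog r + Real.posLog r⁻¹ = |Real.log r| := by
    intro r
    rw [← Real.half_mul_log_add_log_abs, ← Real.half_mul_log_add_log_abs, Real.log_inv, abs_neg]
    ring
  have hfinsum : ∀ a : Fin n → ℤ, logHeight₁ (∏ j, x j ^ a j) =
      ∑ v : InfinitePlace K, v.mult * Real.posLog (v (∏ j, x j ^ a j)) +
        ∑ v ∈ S, Real.posLog (v (∏ j, x j ^ a j)) := by
    intro a
    rw [NumberField.logHeight₁_eq, finsum_eq_sum_of_support_subset]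
    intro v hv
    by_contra hvS
    exact hv (by simp [hlogS v hvS a])
  refine ⟨InfinitePlace K ⊕ S, inferInstance,
    Sum.elim (fun v j => Real.log (v.1 (x j))) (fun v j => Real.log (v.1.1 (x j))),
    Sum.elim (fun v => v.mult) (fun _ => 1), ?_, fun a => ?_⟩
  · rintro (v | v)
    · exact Nat.one_le_cast.mpr v.mult_pos
    · exact le_rfl
  · have hinv : logHeight₁ (∏ j, x j ^ a j) = logHeight₁ (∏ j, x j ^ (-a) j) := by
      rw [← logHeight₁_inv]
      simp
    have hneg : (∏ j, x j ^ (-a) j) = (∏ j, x j ^ a j)⁻¹ := by simp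
    rw [two_mul]
    nth_rewrite 2 [hinv]
    rw [hfinsum, hfinsum, hneg, add_add_add_comm, ← Finset.sum_add_distrib,
      ← Finset.sum_add_distrib, Fintype.sum_sum_type, ← Finset.sum_coe_sort S]
    simp only [Sum.elim_inl, Sum.elim_inr, one_mul, map_inv₀, ← mul_add, habs]
    congr 1
    · exact Finset.sum_congr rfl fun v _ => by rw [← hlog v.1 a]; rfl
    · exact Finset.sum_congr rfl fun v _ => by rw [← hlog v.1.1 a]; rfl

/-- Stacking the logarithm vectors of all places into one vector `u` yields a single `μ` for all of
them. The height is squeezed between constant multiples of `‖T^p u‖`. -/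
theorem exists_hasEigenvalue_logHeight {K : Type} [Field K] [NumberField K] {n : ℕ}
    (B : Matrix (Fin n) (Fin n) ℤ) (x : Fin n → K) (hx : ∀ i, x i ≠ 0)
    (hnt : ∃ i, logHeight₁ (x i) ≠ 0) :
    ∃ μ : ℂ, Module.End.HasEigenvalue (Matrix.toLin' (B.map (Int.cast : ℤ → ℂ))) μ ∧
      (∃ c > 0, ∀ p : ℕ, c * ‖μ‖ ^ p ≤
        logHeight (Fin.cons 1 fun i => ∏ j, x j ^ (B ^ p) i j : Fin (n + 1) → K)) ∧
      ∀ s, ‖μ‖ < s → ∃ C > 0, ∀ p : ℕ,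
        logHeight (Fin.cons 1 fun i => ∏ j, x j ^ (B ^ p) i j : Fin (n + 1) → K) ≤ C * s ^ p := by
  obtain ⟨ι, _, l, w, hw, hl⟩ := exists_two_mul_logHeight₁_prod_zpow x hx
  set Bc : Matrix (Fin n) (Fin n) ℂ := B.map (Int.cast : ℤ → ℂ)
  let T : Module.End ℂ (ι → Fin n → ℂ) :=
    LinearMap.pi fun v => Matrix.toLin' Bc ∘ₗ LinearMap.proj v
  let u : ι → Fin n → ℂ := fun v j => l v j
  have hT : ∀ (p : ℕ) (v : ι), (T ^ p) u v = (Bc ^ p).mulVec (u v) := by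
    intro p v
    induction p with
    | zero => simp
    | succ p ih =>
      rw [pow_succ', Module.End.mul_apply, pow_succ', ← Matrix.mulVec_mulVec, ← ih]
      rfl
  have hBc : ∀ p : ℕ, Bc ^ p = (B ^ p).map (Int.cast : ℤ → ℂ) := fun p =>
    (map_pow (Int.castRingHom ℂ).mapMatrix B p).symm
  have hnorm : ∀ (p : ℕ) (v : ι) (i : Fin n),
      ‖(T ^ p) u v i‖ = |∑ j, ((B ^ p) i j : ℝ) * l v j| := by
    intro p v i
    rw [hT, hBc, ← Real.norm_eq_abs, ← Complex.norm_real]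
    congr 1
    simp [Matrix.mulVec, dotProduct, u]
  set g : ℕ → ℝ := fun p => ∑ i, logHeight₁ (∏ j, x j ^ (B ^ p) i j) with hg
  have hg2 : ∀ p, 2 * g p = ∑ i, ∑ v, w v * ‖(T ^ p) u v i‖ := by
    intro p
    rw [hg, Finset.mul_sum]
    exact Finset.sum_congr rfl fun i _ => by
      rw [hl]
      exact Finset.sum_congr rfl fun v _ => by rw [hnorm]
  have hw0 : ∀ v, 0 ≤ w v := fun v => zero_le_one.trans (hw v)
  have hlow : ∀ p, ‖(T ^ p) u‖ ≤ 2 * g p := by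
    intro p
    have hnn : 0 ≤ 2 * g p := by
      rw [hg2]
      exact Finset.sum_nonneg fun i _ => Finset.sum_nonneg fun v _ =>
        mul_nonneg (hw0 v) (norm_nonneg _)
    refine (pi_norm_le_iff_of_nonneg hnn).mpr fun v => (pi_norm_le_iff_of_nonneg hnn).mpr fun i => ?_
    rw [hg2]
    calc ‖(T ^ p) u v i‖ ≤ w v * ‖(T ^ p) u v i‖ := le_mul_of_one_le_left (norm_nonneg _) (hw v)
      _ ≤ ∑ v, w v * ‖(T ^ p) u v i‖ :=
        Finset.single_le_sum (f := fun v => w v * ‖(T ^ p) u v i‖)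
          (fun v _ => mul_nonneg (hw0 v) (norm_nonneg _)) (Finset.mem_univ v)
      _ ≤ _ := Finset.single_le_sum (f := fun i => ∑ v, w v * ‖(T ^ p) u v i‖)
          (fun i _ => Finset.sum_nonneg fun v _ => mul_nonneg (hw0 v) (norm_nonneg _))
          (Finset.mem_univ i)
  have hup : ∀ p, 2 * g p ≤ (∑ _i : Fin n, ∑ v, w v) * ‖(T ^ p) u‖ := by
    intro p
    rw [hg2, Finset.sum_mul]
    refine Finset.sum_le_sum fun i _ => ?_
    rw [Finset.sum_mul]
    refine Finset.sum_le_sum fun v _ => mul_le_mul_of_nonneg_left ?_ (hw0 v)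
    exact (norm_le_pi_norm _ i).trans (norm_le_pi_norm _ v)
  have hgle : ∀ p, g p ≤
      n * logHeight (Fin.cons 1 fun i => ∏ j, x j ^ (B ^ p) i j : Fin (n + 1) → K) := by
    intro p
    refine (Finset.sum_le_card_nsmul _ _ _ fun i _ => logHeight₁_le_logHeight_cons_one
      (fun i => ∏ j, x j ^ (B ^ p) i j) i).trans ?_
    simp
  -- If `u = 0`, the case `p = 0` of the upper bound makes every coordinate height vanish.
  have hu : u ≠ 0 := by
    intro hu
    obtain ⟨i, hi⟩ := hnt
    have h0 := hup 0
    rw [hu, map_zero, norm_zero, mul_zero] at h0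
    have h1 : logHeight₁ (x i) ≤ g 0 := by
      have := Finset.single_le_sum (f := fun i => logHeight₁ (∏ j, x j ^ (B ^ 0) i j))
        (fun i _ => zero_le_logHeight₁ _) (Finset.mem_univ i)
      refine le_trans (le_of_eq ?_) this
      simp only [pow_zero, Matrix.one_apply]
      rw [Finset.prod_eq_single i] <;> simp +contextual [eq_comm]
    exact hi (le_antisymm (by linarith) (zero_le_logHeight₁ _))
  obtain ⟨μ, hμ, ⟨c, hc, hcl⟩, hs⟩ := exists_hasEigenvalue_norm_iterate T hu
  have hn : 0 < (n : ℝ) := by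
    obtain ⟨i, -⟩ := hnt
    exact_mod_cast i.pos
  refine ⟨μ, ?_, ⟨c / (2 * n), by positivity, fun p => ?_⟩, fun s hμs => ?_⟩
  · obtain ⟨z, hz⟩ := hμ.exists_hasEigenvector
    obtain ⟨v, hv⟩ := Function.ne_iff.mp hz.2
    refine Module.End.hasEigenvalue_of_hasEigenvector
      (x := z v) ⟨Module.End.mem_eigenspace_iff.mpr ?_, hv⟩
    exact congrFun hz.apply_eq_smul v
  · rw [div_mul_eq_mul_div, div_le_iff₀ (by positivity)]
    linarith [hcl p, hlow p, hgle p]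
  · obtain ⟨C, hC, h⟩ := hs s hμs
    have hW : 0 ≤ ∑ _i : Fin n, ∑ v, w v :=
      Finset.sum_nonneg fun _ _ => Finset.sum_nonneg fun v _ => hw0 v
    have hs0 : 0 < s := (norm_nonneg μ).trans_lt hμs
    refine ⟨(∑ _i : Fin n, ∑ v, w v) * C + 1, by positivity, fun p => ?_⟩
    refine (logHeight_cons_one_le_sum _).trans ?_
    change g p ≤ _
    have h1 := (hup p).trans (mul_le_mul_of_nonneg_left (h p) hW)
    have h2 : 0 ≤ g p := Finset.sum_nonneg fun _ _ => zero_le_logHeight₁ _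
    have h3 : 0 < s ^ p := by positivity
    linarith

end HeightGrowth

/-! ### Transfer to the torus and conclusion. -/

/-- Applying `φ(adj B)` to a torsion image `φ(B)(x)` gives `x^(det B)`, so `x` would be torsion. -/
theorem exists_not_isOfFinOrder_monomialMap {n : ℕ} {B : Matrix (Fin n) (Fin n) ℤ}
    (hB : B.det ≠ 0) {x : Torus n} (hx : ∃ i, ¬ IsOfFinOrder (x i)) :
    ∃ i, ¬ IsOfFinOrder (monomialMap B x i) := by
  by_contra! h
  obtain ⟨i, hi⟩ := hx
  refine hi ?_
  have h1 : IsOfFinOrder (monomialHom B.adjugate (monomialMap B x)) :=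
    MonoidHom.isOfFinOrder _ (IsOfFinOrder.pi h)
  have h2 : monomialHom B.adjugate (monomialMap B x) = x ^ B.det := by
    change monomialMap _ _ = _
    rw [← monomialMap_mul, Matrix.adjugate_mul, monomialMap_smul_one]
  have h3 := h1.zpow (i := B.det.sign)
  rw [h2, ← zpow_mul, Int.mul_sign_self, zpow_natCast] at h3
  exact (h3.of_pow (Int.natAbs_ne_zero.mpr hB)).apply i

theorem isEigenvalueOfQuotient_div {n : ℕ} {M N : Matrix (Fin n) (Fin n) ℤ} (hM : M.det ≠ 0)
    {μ : ℂ} (hμ : Module.End.HasEigenvalue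
      (Matrix.toLin' ((quotientMatrix M N).map (Int.cast : ℤ → ℂ))) μ) :
    IsEigenvalueOfQuotient M N (μ / (M.det.natAbs : ℂ)) := by
  set Mc := M.map (Int.cast : ℤ → ℂ)
  set Nc := N.map (Int.cast : ℤ → ℂ)
  set Bc := (quotientMatrix M N).map (Int.cast : ℤ → ℂ)
  have hk : (M.det.natAbs : ℂ) ≠ 0 := Nat.cast_ne_zero.mpr (Int.natAbs_ne_zero.mpr hM)
  have hdet : IsUnit Mc.det := by
    rw [isUnit_iff_ne_zero, show Mc.det = (M.det : ℂ) from
      ((Int.castRingHom ℂ).map_det M).symm]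
    exact_mod_cast hM
  have hmul : Bc * Mc = (M.det.natAbs : ℂ) • Nc := by
    have h := congrArg (Int.castRingHom ℂ).mapMatrix (quotientMatrix_mul M N)
    rw [map_mul, map_nsmul] at h
    rw [Nat.cast_smul_eq_nsmul]
    exact h
  have hB : Bc = (M.det.natAbs : ℂ) • (Nc * Mc⁻¹) := by
    rw [← smul_mul_assoc, ← hmul, Matrix.mul_nonsing_inv_cancel_right _ _ hdet]
  obtain ⟨z, hz⟩ := hμ.exists_hasEigenvector
  refine Module.End.hasEigenvalue_of_hasEigenvector
    (x := z) ⟨Module.End.mem_eigenspace_iff.mpr ?_, hz.2⟩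
  have h := hz.apply_eq_smul
  rw [hB, map_smul, LinearMap.smul_apply] at h
  rw [div_eq_inv_mul, mul_smul, ← h, smul_smul, inv_mul_cancel₀ hk, one_smul]

/-- Growth of the height along the iterates of a monomial map. -/
theorem exists_hasEigenvalue_torusHeight {n : ℕ} {B : Matrix (Fin n) (Fin n) ℤ} (hB : B.det ≠ 0)
    {x : Torus n} (hx : ∃ i, ¬ IsOfFinOrder (x i)) :
    ∃ μ : ℂ, Module.End.HasEigenvalue (Matrix.toLin' (B.map (Int.cast : ℤ → ℂ))) μ ∧
      (∃ c > 0, ∀ p : ℕ, c * ‖μ‖ ^ p ≤ torusHeight (monomialMap (B ^ p) x)) ∧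
      (∀ s, ‖μ‖ < s → ∃ C > 0, ∀ p : ℕ, torusHeight (monomialMap (B ^ p) x) ≤ C * s ^ p) ∧
      ∃ c > 0, ∀ p : ℕ, c ≤ torusHeight (monomialMap (B ^ p) x) := by
  let K := IntermediateField.adjoin ℚ (Set.range fun i => (x i : QBar))
  have : NumberField K := numberField_adjoin_range x
  have hxK : ∀ i, (x i : QBar) ∈ K := fun i => IntermediateField.subset_adjoin ℚ _ ⟨i, rfl⟩
  let X : Fin n → Kˣ := fun i =>
    Units.mk0 ⟨x i, hxK i⟩ fun h => (x i).ne_zero (congrArg Subtype.val h)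
  let e : Kˣ →* QBarˣ := Units.map K.val.toRingHom.toMonoidHom
  have hinj : Function.Injective e := Units.map_injective K.val.injective
  have hX : ∀ i, e (X i) = x i := fun i => Units.ext rfl
  let Y : ℕ → Fin n → Kˣ := fun p i => ∏ j, X j ^ (B ^ p) i j
  have hY : ∀ p i, e (Y p i) = monomialMap (B ^ p) x i := fun p i => by
    simp [Y, monomialMap, hX]
  have hYval : ∀ p i, ((Y p i : K) : QBar) = monomialMap (B ^ p) x i := fun p i => by
    rw [← hY]; rfl
  have hmem : ∀ p i, (monomialMap (B ^ p) x i : QBar) ∈ K := fun p i => by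
    rw [← hYval]; exact (Y p i : K).2
  have hprod : ∀ p i, (Y p i : K) = ∏ j, (X j : K) ^ (B ^ p) i j := fun p i => by simp [Y]
  set D : ℝ := (Module.finrank ℚ K : ℝ)
  have hD : 0 < D := Nat.cast_pos.mpr Module.finrank_pos
  have hheight : ∀ p, torusHeight (monomialMap (B ^ p) x) =
      Height.logHeight (Fin.cons 1 fun i => (Y p i : K) : Fin (n + 1) → K) / D := fun p => by
    rw [torusHeight_eq _ K (hmem p)]
    congr 3
    funext i
    exact Subtype.ext (hYval p i).symm
  have hfin : ∀ a : Kˣ, IsOfFinOrder (e a) ↔ IsOfFinOrder a := fun a =>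
    hinj.isOfFinOrder_iff
  obtain ⟨i₀, hi₀⟩ := hx
  obtain ⟨μ, hμ, ⟨c, hc, hlow⟩, hup⟩ := exists_hasEigenvalue_logHeight B (fun i => (X i : K))
    (fun i => (X i).ne_zero) ⟨i₀, fun h => hi₀ (by
      rw [← hX, hfin]; exact isOfFinOrder_of_logHeight₁_eq_zero h)⟩
  simp only [← hprod] at hlow hup
  refine ⟨μ, hμ, ⟨c / D, by positivity, fun p => ?_⟩, fun s hs => ?_, ?_⟩
  · rw [hheight, div_mul_eq_mul_div]
    gcongr
    exact hlow p
  · obtain ⟨C, hC, h⟩ := hup s hs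
    refine ⟨C / D, by positivity, fun p => ?_⟩
    rw [hheight, div_mul_eq_mul_div]
    gcongr
    exact h p
  -- The whole orbit lies in the fixed field `K` and never becomes torsion, so one constant works
  -- for all `p`.
  · obtain ⟨c, hc, h⟩ := exists_pos_le_logHeight₁ K
    refine ⟨c / D, by positivity, fun p => ?_⟩
    obtain ⟨i, hi⟩ := exists_not_isOfFinOrder_monomialMap
      (B := B ^ p) (by rw [Matrix.det_pow]; exact pow_ne_zero p hB) ⟨i₀, hi₀⟩
    rw [hheight]
    gcongr
    refine (h (Y p i) (by rwa [← hfin, hY])).trans ?_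
    exact logHeight₁_le_logHeight_cons_one (fun i => (Y p i : K)) i

theorem theoremD (n : ℕ) (M N : Matrix (Fin n) (Fin n) ℤ) (hM : M.det ≠ 0) (hN : N.det ≠ 0)
    (d : ℕ) (hd : 0 < d) (x : Torus n) :
    arithmeticDegree d (monomialCorrespondence M N) x ≠ ⊤ ∧
    (∃ r ∈ ({1} ∪ {r : ℝ | ∃ ρ : ℂ, IsEigenvalueOfQuotient M N ρ ∧ r = ‖(M.det : ℂ) * ρ‖} : Set ℝ),
      arithmeticDegree d (monomialCorrespondence M N) x = ENNReal.ofReal r) ∧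
    ((∃ i, ¬ IsOfFinOrder (x i)) →
      limsup (fun p : ℕ =>
          ENNReal.ofReal (orbitHeight d (monomialCorrespondence M N) x p) ^ (1 / (p : ℝ))) atTop
        = arithmeticDegree d (monomialCorrespondence M N) x) := by
  have hd' : (0 : ℝ) < d := Nat.cast_pos.mpr hd
  rw [arithmeticDegree]
  simp only [orbitHeight_eq hM]
  by_cases hx : ∃ i, ¬ IsOfFinOrder (x i)
  · obtain ⟨μ, hμ, ⟨c, hc, hlow⟩, hup, ⟨b, hb, hbd⟩⟩ :=
      exists_hasEigenvalue_torusHeight (det_quotientMatrix_ne_zero hM hN) hx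
    set a : ℕ → ℝ := fun p => d * torusHeight (monomialMap (quotientMatrix M N ^ p) x)
    have hlow' : ∃ c > 0, ∀ p : ℕ, c * ‖μ‖ ^ p ≤ a p :=
      ⟨d * c, by positivity, fun p => by
        rw [mul_assoc]; exact mul_le_mul_of_nonneg_left (hlow p) hd'.le⟩
    have hup' : ∀ s, ‖μ‖ < s → ∃ C > 0, ∀ p : ℕ, a p ≤ C * s ^ p := fun s hs => by
      obtain ⟨C, hC, h⟩ := hup s hs
      exact ⟨d * C, by positivity, fun p => by
        rw [mul_assoc]; exact mul_le_mul_of_nonneg_left (h p) hd'.le⟩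
    -- Otherwise the heights would tend to 0, against the lower bound `b`.
    have hone : 1 ≤ ‖μ‖ := by
      by_contra! hlt
      obtain ⟨s, hs, hs1⟩ := exists_between hlt
      obtain ⟨C, -, h⟩ := hup s hs
      have hlim : Tendsto (fun p : ℕ => C * s ^ p) atTop (nhds (C * 0)) :=
        (tendsto_pow_atTop_nhds_zero_of_lt_one ((norm_nonneg μ).trans hs.le) hs1).const_mul C
      have := ge_of_tendsto' hlim fun p => (hbd p).trans (h p)
      linarith
    have hlim := limsup_rpow_eq_ofReal (norm_nonneg μ) hlow' hup'
    have hlim' : limsup (fun p : ℕ => ENNReal.ofReal (max 1 (a p)) ^ (1 / (p : ℝ))) atTop =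
        ENNReal.ofReal ‖μ‖ := by
      refine limsup_rpow_eq_ofReal (norm_nonneg μ) ?_ fun s hs => ?_
      · obtain ⟨c, hc, h⟩ := hlow'
        exact ⟨c, hc, fun p => (h p).trans (le_max_right _ _)⟩
      · obtain ⟨C, hC, h⟩ := hup' s hs
        have hs1 : 1 ≤ s := hone.trans hs.le
        -- Since `s ≥ 1`, this constant also dominates the 1 in `max 1 (a p)`.
        refine ⟨max 1 C, by positivity, fun p => max_le ?_ ((h p).trans ?_)⟩
        · exact one_le_mul_of_one_le_of_one_le (le_max_left _ _) (one_le_pow₀ hs1)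
        · gcongr
          exact le_max_right _ _
    refine ⟨?_, ⟨‖μ‖, Or.inr ⟨_, isEigenvalueOfQuotient_div hM hμ, ?_⟩, hlim'⟩,
      fun _ => hlim.trans hlim'.symm⟩
    · rw [hlim']
      exact ENNReal.ofReal_ne_top
    · have hk : (M.det.natAbs : ℝ) ≠ 0 := Nat.cast_ne_zero.mpr (Int.natAbs_ne_zero.mpr hM)
      have hnorm : ‖(M.det : ℂ)‖ = M.det.natAbs := by
        rw [Complex.norm_intCast, Nat.cast_natAbs, Int.cast_abs]
      rw [norm_mul, norm_div, hnorm, Complex.norm_natCast, mul_div_cancel₀ _ hk]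
  · have hx' : ∀ i, IsOfFinOrder (x i) := by simpa using hx
    have hzero : ∀ p, torusHeight (monomialMap (quotientMatrix M N ^ p) x) = 0 := fun p => by
      have h : IsOfFinOrder (monomialHom (quotientMatrix M N ^ p) x) :=
        MonoidHom.isOfFinOrder _ (IsOfFinOrder.pi hx')
      exact torusHeight_eq_zero_of_isOfFinOrder fun i => h.apply i
    simp only [hzero, mul_zero, zero_le_one, sup_of_le_left, ENNReal.ofReal_one,
      ENNReal.one_rpow, limsup_const]
    exact ⟨ENNReal.one_ne_top, ⟨1, Or.inl rfl, ENNReal.ofReal_one.symm⟩, fun h => (hx h).elim⟩
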